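/- Fix the reference basis $|1\rangle,\dots,|n\rangle$ of $\mathbb{C}^n$ ($n\ge 1$), and let $\Delta(X)=\sum_i |i\rangle\langle i|X|i\rangle\langle i|$ denote the dephasing map. An incoherent state is a density matrix that is diagonal in the reference basis. MIO is the class of completely positive trace-preserving linear maps that send every incoherent state to an incoherent state, and DIO is the class of completely positive trace-preserving linear maps $\mathcal E$ with $\Delta\circ\mathcal E=\mathcal E\circ\Delta$. Let $|\Psi_m\rangle=m^{-1/2}\sum_{i=1}^m|i\rangle$, $\Psi_m=|\Psi_m\rangle\langle\Psi_m|$, and $F(\rho,\sigma)=\|\sqrt\rho\sqrt\sigma\|_1^2$. For $\mathcal O\in\{\mathrm{DIO},\mathrm{MIO}\}$, a state $\rho$ and $\varepsilon\ge 0$, let $P_{\mathcal O}(\rho\to\Psi_m,\varepsilon)$ be the maximal $p\in[0,1]$ for which there are density matrices $\sigma,\omega$ on $\mathbb{C}^m$ and a map $\Pi\in\mathcal O$ into the operators on $\mathbb{C}^2\otimes\mathbb{C}^m$ (flag and output, with the product reference basis) such that $$\Pi(\rho)=p\,|0\rangle\langle 0|\otimes\sigma+(1-p)\,|1\rangle\langle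 1|\otimes\omega,\qquad F(\sigma,\Psi_m)\ge 1-\varepsilon .$$ Let $|\varphi\rangle=\sum_{i=1}^n\varphi_i|i\rangle$ be a unit vector with $\varphi_1\ge\dots\ge\varphi_n>0$, let $\varphi=|\varphi\rangle\langle\varphi|$, and let $\varepsilon\ge 0$. Then, for $\mathcal O\in\{\mathrm{DIO},\mathrm{MIO}\}$, the maximum defining $P_{\mathcal O}(\varphi\to\Psi_2,\varepsilon)$ is attained and $$P_{\mathcal O}(\varphi\to\Psi_2,\varepsilon)=\begin{cases}1&\text{if }\varepsilon\ge\varepsilon_0(\varphi_1),\\[2pt] 2(1-\varphi_1^2)\left(\dfrac{\sqrt{1-\varepsilon}+\sqrt{\varepsilon}}{1-2\varepsilon}\right)^2&\text{otherwise,}\end{cases}$$ where $\varepsilon_0(\varphi_1)=0$ if $\varphi_1\le 1/\sqrt2$ and $\varepsilon_0(\varphi_1)=\tfrac12-\varphi_1\sqrt{1-\varphi_1^2}$ otherwise. -/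

import Mathlib

open scoped ComplexOrder MatrixOrder Kronecker

namespace CoherenceDistillation

noncomputable section

/-- A quantum state (density operator) on the space with reference basis `a`. -/
def IsState {a : Type*} [Fintype a] (ρ : Matrix a a ℂ) : Prop :=
  ρ.PosSemidef ∧ ρ.trace = 1

/-- The completely dephasing channel `Δ`, which deletes the off-diagonal entries. -/
def dephase {a : Type*} [DecidableEq a] (X : Matrix a a ℂ) : Matrix a a ℂ :=
  Matrix.diagonal fun i => X i i

/-- An incoherent state: a state that is diagonal in the reference basis. -/
def IsIncoherent {a : Type*} [Fintype a] (ρ : Matrix a a ℂ) : Prop :=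
  IsState ρ ∧ ρ.IsDiag

/-- The ampliation `id_k ⊗ E` of a linear map `E`, acting on `k × k` block matrices blockwise. -/
def ampliation {a b : Type*} (k : ℕ) (E : Matrix a a ℂ →ₗ[ℂ] Matrix b b ℂ)
    (M : Matrix (Fin k × a) (Fin k × a) ℂ) : Matrix (Fin k × b) (Fin k × b) ℂ :=
  Matrix.of fun r s => E (Matrix.of fun x y => M (r.1, x) (s.1, y)) r.2 s.2

/-- Complete positivity: every ampliation preserves positive semidefiniteness. -/
def IsCompletelyPositive {a b : Type*} (E : Matrix a a ℂ →ₗ[ℂ] Matrix b b ℂ) : Prop :=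
  ∀ (k : ℕ) (M : Matrix (Fin k × a) (Fin k × a) ℂ),
    M.PosSemidef → (ampliation k E M).PosSemidef

/-- A quantum operation (channel): a completely positive trace-preserving linear map. -/
def IsChannel {a b : Type*} [Fintype a] [Fintype b]
    (E : Matrix a a ℂ →ₗ[ℂ] Matrix b b ℂ) : Prop :=
  IsCompletelyPositive E ∧ ∀ X, (E X).trace = X.trace

/-- Maximally incoherent operations: channels that map incoherent states to incoherent states. -/
def IsMaximallyIncoherentOperation {a b : Type*} [Fintype a] [Fintype b]
    (E : Matrix a a ℂ →ₗ[ℂ] Matrix b b ℂ) : Prop :=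
  IsChannel E ∧ ∀ ρ, IsIncoherent ρ → IsIncoherent (E ρ)

/-- Dephasing-covariant incoherent operations: channels that commute with `Δ`. -/
def IsDephasingCovariantOperation {a b : Type*} [Fintype a] [DecidableEq a] [Fintype b] [DecidableEq b]
    (E : Matrix a a ℂ →ₗ[ℂ] Matrix b b ℂ) : Prop :=
  IsChannel E ∧ ∀ X, dephase (E X) = E (dephase X)

/-- The two classes of free operations under consideration. -/
inductive OperationClass
  | dephasingCovariant
  | maximallyIncoherent

/-- `O.Contains E` means that the linear map `E` belongs to the operation class `O`. -/
def OperationClass.Contains (O : OperationClass) {a b : Type*}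
    [Fintype a] [DecidableEq a] [Fintype b] [DecidableEq b]
    (E : Matrix a a ℂ →ₗ[ℂ] Matrix b b ℂ) : Prop :=
  match O with
  | .dephasingCovariant => IsDephasingCovariantOperation E
  | .maximallyIncoherent => IsMaximallyIncoherentOperation E

/-- The trace norm `‖X‖₁ = Tr √(X† X)`. -/
def traceNorm {a : Type*} [Fintype a] [DecidableEq a] (X : Matrix a a ℂ) : ℝ :=
  (CFC.sqrt (X.conjTranspose * X)).trace.re

/-- The fidelity `F(ρ, σ) = ‖√ρ √σ‖₁²`. -/
def fidelity {a : Type*} [Fintype a] [DecidableEq a] (ρ σ : Matrix a a ℂ) : ℝ :=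
  traceNorm (CFC.sqrt ρ * CFC.sqrt σ) ^ 2

/-- The rank-one operator `|ψ⟩⟨ψ|`. -/
def pureState {a : Type*} (ψ : a → ℂ) : Matrix a a ℂ :=
  Matrix.vecMulVec ψ (star ψ)

/-- The maximally coherent state `Ψ_m = |Ψ_m⟩⟨Ψ_m|`, where `|Ψ_m⟩ = m^{-1/2} ∑ᵢ |i⟩`. -/
def maxCoherent (m : ℕ) : Matrix (Fin m) (Fin m) ℂ :=
  pureState fun _ => ((1 / √(m : ℝ) : ℝ) : ℂ)

/-- The output `p |0⟩⟨0| ⊗ σ + (1 - p) |1⟩⟨1| ⊗ ω` of a probabilistic protocol with a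
one-bit flag register. -/
def flaggedOutput {m : ℕ} (p : ℝ) (σ ω : Matrix (Fin m) (Fin m) ℂ) :
    Matrix (Fin 2 × Fin m) (Fin 2 × Fin m) ℂ :=
  (p : ℂ) • (Matrix.single (0 : Fin 2) (0 : Fin 2) (1 : ℂ) ⊗ₖ σ) +
    ((1 - p : ℝ) : ℂ) • (Matrix.single (1 : Fin 2) (1 : Fin 2) (1 : ℂ) ⊗ₖ ω)

/-- The probabilities `p` with which some operation in the class `O` turns `ρ` into a state of
fidelity at least `1 - ε` with `Ψ_m`. The reference basis of the joint flag-output system is the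
product basis, indexed by `Fin 2 × Fin m`. -/
def achievableProbabilities (O : OperationClass) {a : Type*} [Fintype a] [DecidableEq a]
    (ρ : Matrix a a ℂ) (m : ℕ) (ε : ℝ) : Set ℝ :=
  {p | 0 ≤ p ∧ p ≤ 1 ∧
    ∃ (E : Matrix a a ℂ →ₗ[ℂ] Matrix (Fin 2 × Fin m) (Fin 2 × Fin m) ℂ)
      (σ ω : Matrix (Fin m) (Fin m) ℂ),
      O.Contains E ∧ IsState σ ∧ IsState ω ∧
      E ρ = flaggedOutput p σ ω ∧ 1 - ε ≤ fidelity σ (maxCoherent m)}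

/-- `P` is the maximal success probability `P_O(ρ → Ψ_m, ε)`; the maximum is attained. -/
def IsMaxSuccessProbability (O : OperationClass) {a : Type*} [Fintype a] [DecidableEq a]
    (ρ : Matrix a a ℂ) (m : ℕ) (ε P : ℝ) : Prop :=
  IsGreatest (achievableProbabilities O ρ m ε) P

/-- The threshold `ε₀(x)`. -/
def thresholdInfidelity (x : ℝ) : ℝ :=
  if x ≤ 1 / √2 then 0 else 1 / 2 - x * √(1 - x ^ 2)

end

end CoherenceDistillation

/-!
The target `Ψ₂` is pure, so `F(σ, Ψ₂) = ⟨Ψ₂|σ|Ψ₂⟩` (`fidelity_maxCoherent`), and a protocol is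
described by the two effects `A` and `C` obtained by pulling back `|0⟩⟨0| ⊗ Ψ₂` and
`|0⟩⟨0| ⊗ (1 - Ψ₂)` through the channel: `⟨φ|A|φ⟩ = p F` and `⟨φ|C|φ⟩ = p (1 - F)`. The operation
classes enter through the diagonals of `A` and `C` only. Since `Ψ₂` and `1 - Ψ₂` have the same
diagonal, a maximally incoherent channel has `Aᵢᵢ = Cᵢᵢ`. Conversely, effects with equal diagonals
and diagonal sum give a dephasing-covariant channel, by measuring and preparing
(`mem_achievableProbabilities_of_witness`). Dephasing-covariant channels are maximally incoherent,
so the converse bound is needed for the larger class, and the protocols for the smaller one.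

*Converse* (`mul_sq_le_of_mem_achievableProbabilities`). Write `φ = x |1⟩ + φ'` with `x = φ₁`. In
the seminorms of `A` and `C` the vector `|1⟩` has the same length, so the triangle inequality gives
`√p (√(1-ε) - √ε) ≤ ‖φ‖_A - ‖φ‖_C ≤ ‖φ'‖_A + ‖φ'‖_C ≤ √(2 (1 - x²))`, the last step because
`A + C ≤ 1`. As `(√(1-ε) - √ε) (√(1-ε) + √ε) = 1 - 2ε`, this is the asserted upper bound.

*Achievability.* In terms of `diag d = A + C` and `K = A - C`, it is required that `K` has zero
diagonal and `-diag d ≤ K ≤ diag d ≤ 1`. If `x² ≤ 1/2`, the populations `φᵢ²` satisfy the polygon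
inequality, so there are phases `zᵢ` with `∑ φᵢ² zᵢ = 0`, and `d = 1`,
`K = |φ⟩⟨φ| - |ψ⟩⟨ψ|` with `ψᵢ = zᵢ φᵢ` distills perfectly
(`one_mem_achievableProbabilities_of_sq_le`). If `x² > 1/2`, let `y = √(1 - x²)` and `w = φ' / y`;
then `d = (t², 1, …, 1)` and `K = t (|1⟩⟨w| + |w⟩⟨1|)` give `p = t² x² + y²` and
`p (2 F - 1) = 2 t x y` (`mem_achievableProbabilities_of_amplitude`). The choice `t = 1` reaches
`p = 1` at infidelity `1/2 - x y`, which is the threshold; below the threshold,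
`t = y (√(1-ε) + √ε) / (x (√(1-ε) - √ε))` is at most one and meets the converse bound.
-/

namespace CoherenceDistillation

open Matrix

variable {a b : Type*}

/-! ### Pure states and the fidelity with the maximally coherent qubit state -/

lemma pureState_posSemidef [Fintype a] (ψ : a → ℂ) : (pureState ψ).PosSemidef :=
  posSemidef_vecMulVec_self_star ψ

lemma trace_pureState [Fintype a] (ψ : a → ℂ) : (pureState ψ).trace = star ψ ⬝ᵥ ψ := by
  rw [pureState, trace_vecMulVec, dotProduct_comm]

lemma trace_mul_pureState [Fintype a] (A : Matrix a a ℂ) (ψ : a → ℂ) :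
    (A * pureState ψ).trace = star ψ ⬝ᵥ (A *ᵥ ψ) := by
  rw [pureState, mul_vecMulVec, trace_vecMulVec, dotProduct_comm]

lemma trace_mul_nonneg [Fintype a] [DecidableEq a] {A B : Matrix a a ℂ} (hA : A.PosSemidef)
    (hB : B.PosSemidef) : 0 ≤ (A * B).trace := by
  obtain ⟨m, v, rfl⟩ := posSemidef_iff_eq_sum_vecMulVec.mp hB
  rw [Finset.mul_sum, trace_sum]
  refine Finset.sum_nonneg fun i _ => ?_
  have := trace_mul_pureState A (v i)
  rw [pureState] at this
  rw [this]
  exact hA.dotProduct_mulVec_nonneg _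

/-- `|ψ⟩⟨ψ| ≤ 1` for a subnormalized vector `ψ`. -/
lemma one_sub_pureState_posSemidef [Fintype a] [DecidableEq a] {ψ : a → ℂ}
    (h : star ψ ⬝ᵥ ψ ≤ 1) : (1 - pureState ψ).PosSemidef := by
  have hP := pureState_posSemidef ψ
  have hsq : pureState ψ * pureState ψ = (star ψ ⬝ᵥ ψ) • pureState ψ := by
    simp [pureState, vecMulVec_mul_vecMulVec]
  have : 1 - pureState ψ = (1 - pureState ψ)ᴴ * (1 - pureState ψ) +
      (1 - star ψ ⬝ᵥ ψ) • pureState ψ := by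
    rw [conjTranspose_sub, conjTranspose_one, hP.isHermitian.eq, sub_mul, mul_sub, mul_sub, hsq,
      sub_smul]
    simp
  rw [this]
  exact (posSemidef_conjTranspose_mul_self _).add (hP.smul (sub_nonneg.2 h))

lemma maxCoherent_two_apply (i j : Fin 2) : maxCoherent 2 i j = 1 / 2 := by
  have : ((√2 : ℝ) : ℂ) * ((√2 : ℝ) : ℂ) = 2 := by
    rw [← Complex.ofReal_mul, Real.mul_self_sqrt (by norm_num)]; norm_num
  simp [maxCoherent, pureState, vecMulVec_apply, ← mul_inv, this]

lemma maxCoherent_mul_self : maxCoherent 2 * maxCoherent 2 = maxCoherent 2 := by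
  ext i j
  simp only [mul_apply, maxCoherent_two_apply, Fin.sum_univ_two]
  norm_num

lemma maxCoherent_posSemidef : (maxCoherent 2).PosSemidef := pureState_posSemidef _

lemma trace_maxCoherent : (maxCoherent 2).trace = 1 := by
  simp only [trace, diag_apply, maxCoherent_two_apply, Fin.sum_univ_two]
  norm_num

lemma one_sub_maxCoherent_posSemidef : (1 - maxCoherent 2).PosSemidef := by
  refine one_sub_pureState_posSemidef (le_of_eq ?_)
  rw [← trace_pureState]
  exact trace_maxCoherent

/-- The target is pure, so the fidelity with it is an expectation value. -/
lemma fidelity_maxCoherent {σ : Matrix (Fin 2) (Fin 2) ℂ} (hσ : σ.PosSemidef) :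
    fidelity σ (maxCoherent 2) = (maxCoherent 2 * σ).trace.re := by
  have hΨ := maxCoherent_posSemidef
  have hsqrt : CFC.sqrt (maxCoherent 2) = maxCoherent 2 :=
    CFC.sqrt_unique maxCoherent_mul_self hΨ.nonneg
  have hS : (CFC.sqrt σ).PosSemidef := nonneg_iff_posSemidef.1 (CFC.sqrt_nonneg σ)
  have hc : 0 ≤ (maxCoherent 2 * σ).trace := trace_mul_nonneg hΨ hσ
  set c : ℝ := (maxCoherent 2 * σ).trace.re with hcdef
  have hc0 : 0 ≤ c := (Complex.nonneg_iff.1 hc).1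
  have hcc : (maxCoherent 2 * σ).trace = c := (Complex.eq_re_of_ofReal_le hc)
  have hgram : (CFC.sqrt σ * maxCoherent 2)ᴴ * (CFC.sqrt σ * maxCoherent 2) =
      (c : ℂ) • maxCoherent 2 := by
    rw [conjTranspose_mul, hS.isHermitian.eq, hΨ.isHermitian.eq, Matrix.mul_assoc,
      ← Matrix.mul_assoc (CFC.sqrt σ), CFC.sqrt_mul_sqrt_self σ hσ.nonneg, ← hcc]
    ext i j
    simp only [mul_apply, maxCoherent_two_apply, Fin.sum_univ_two, trace, diag_apply,
      Matrix.smul_apply, smul_eq_mul]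
    ring
  have hroot : CFC.sqrt ((c : ℂ) • maxCoherent 2) = ((√c : ℝ) : ℂ) • maxCoherent 2 := by
    refine CFC.sqrt_unique ?_ (hΨ.smul (by exact_mod_cast Real.sqrt_nonneg c)).nonneg
    rw [Matrix.smul_mul, Matrix.mul_smul, maxCoherent_mul_self, smul_smul, ← Complex.ofReal_mul,
      Real.mul_self_sqrt hc0]
  rw [fidelity, traceNorm, hsqrt, hgram, hroot, trace_smul, trace_maxCoherent, smul_eq_mul, mul_one,
    Complex.ofReal_re, Real.sq_sqrt hc0]

/-! ### Completely positive maps -/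

lemma IsCompletelyPositive.posSemidef {E : Matrix a a ℂ →ₗ[ℂ] Matrix b b ℂ}
    (hE : IsCompletelyPositive E) {X : Matrix a a ℂ} (hX : X.PosSemidef) : (E X).PosSemidef :=
  (hE 1 _ (hX.submatrix Prod.snd)).submatrix fun x => (0, x)

lemma IsCompletelyPositive.add {E F : Matrix a a ℂ →ₗ[ℂ] Matrix b b ℂ}
    (hE : IsCompletelyPositive E) (hF : IsCompletelyPositive F) :
    IsCompletelyPositive (E + F) := fun k M hM => (hE k M hM).add (hF k M hM)

/-- The map `X ↦ Tr(A X) N`: measure the effect `A`, and prepare `N` when it occurs. -/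
noncomputable def measurePrepare [Fintype a] (A : Matrix a a ℂ) (N : Matrix b b ℂ) :
    Matrix a a ℂ →ₗ[ℂ] Matrix b b ℂ :=
  (traceLinearMap a ℂ ℂ ∘ₗ LinearMap.mulLeft ℂ A).smulRight N

lemma measurePrepare_apply [Fintype a] (A : Matrix a a ℂ) (N : Matrix b b ℂ) (X : Matrix a a ℂ) :
    measurePrepare A N X = (A * X).trace • N := rfl

lemma isCompletelyPositive_measurePrepare [Fintype a] [Fintype b] {A : Matrix a a ℂ}
    {N : Matrix b b ℂ} (hA : A.PosSemidef) (hN : N.PosSemidef) :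
    IsCompletelyPositive (measurePrepare A N) := by
  classical
  intro k M hM
  have key : (Matrix.of fun r s : Fin k =>
      (A * Matrix.of fun x y => M (r, x) (s, y)).trace).PosSemidef := by
    obtain ⟨m, v, rfl⟩ := posSemidef_iff_eq_sum_vecMulVec.mp hA
    -- Each rank-one summand `v v†` of `A` contributes the compression of `M` by `1 ⊗ v`.
    have : (Matrix.of fun r s : Fin k => ((∑ i, vecMulVec (v i) (star (v i))) *
        Matrix.of fun x y => M (r, x) (s, y)).trace) =
        ∑ i, (Matrix.of fun (p : Fin k × a) (r : Fin k) => if p.1 = r then v i p.2 else 0)ᴴ * M *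
          (Matrix.of fun (p : Fin k × a) (r : Fin k) => if p.1 = r then v i p.2 else 0) := by
      ext r s
      rw [of_apply, Finset.sum_mul, trace_sum, Matrix.sum_apply]
      refine Finset.sum_congr rfl fun i _ => ?_
      rw [vecMulVec_mul, trace_vecMulVec]
      simp [Matrix.mul_apply, dotProduct, vecMul, Fintype.sum_prod_type, apply_ite,
        mul_comm]
    rw [this]
    exact posSemidef_sum _ fun i _ => hM.conjTranspose_mul_mul_same _
  exact key.kronecker hN

/-! ### Dephasing-covariant protocols from a pair of success effects -/

lemma dephase_eq_self [DecidableEq a] {X : Matrix a a ℂ} (hX : X.IsDiag) : dephase X = X :=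
  hX.diagonal_diag

lemma IsDephasingCovariantOperation.isMaximallyIncoherentOperation [Fintype a] [DecidableEq a]
    [Fintype b] [DecidableEq b] {E : Matrix a a ℂ →ₗ[ℂ] Matrix b b ℂ}
    (hE : IsDephasingCovariantOperation E) : IsMaximallyIncoherentOperation E := by
  refine ⟨hE.1, fun ρ hρ => ⟨⟨hE.1.1.posSemidef hρ.1.1, (hE.1.2 ρ).trans hρ.1.2⟩, ?_⟩⟩
  rw [← dephase_eq_self hρ.2, ← hE.2]
  exact isDiag_diagonal _

lemma OperationClass.contains_of_dephasingCovariant (O : OperationClass) [Fintype a] [DecidableEq a]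
    [Fintype b] [DecidableEq b] {E : Matrix a a ℂ →ₗ[ℂ] Matrix b b ℂ}
    (hE : IsDephasingCovariantOperation E) : O.Contains E := by
  cases O
  · exact hE
  · exact hE.isMaximallyIncoherentOperation

lemma OperationClass.Contains.isMaximallyIncoherentOperation {O : OperationClass} [Fintype a]
    [DecidableEq a] [Fintype b] [DecidableEq b] {E : Matrix a a ℂ →ₗ[ℂ] Matrix b b ℂ}
    (hE : O.Contains E) : IsMaximallyIncoherentOperation E := by
  cases O
  · exact IsDephasingCovariantOperation.isMaximallyIncoherentOperation hE
  · exact hE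

/-- The flag projection `|s⟩⟨s|`. -/
def flag (s : Fin 2) : Matrix (Fin 2) (Fin 2) ℂ := Matrix.single s s 1

lemma flag_posSemidef (s : Fin 2) : (flag s).PosSemidef := by
  rw [flag, ← diagonal_single]
  exact PosSemidef.diagonal (by
    intro i
    simp only [Pi.zero_apply, Pi.single_apply]
    split_ifs <;> simp)

lemma trace_flag (s : Fin 2) : (flag s).trace = 1 := by
  simp [flag]

/-- The measurement with success effects `(diag d ± K) / 2` and failure effect `1 - diag d`,
followed by the preparation of `|0⟩⟨0| ⊗ Ψ₂`, `|0⟩⟨0| ⊗ (1 - Ψ₂)` and `|1⟩⟨1| ⊗ 1/2`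
respectively. -/
noncomputable def distill [Fintype a] [DecidableEq a] (d : a → ℝ) (K : Matrix a a ℂ) :
    Matrix a a ℂ →ₗ[ℂ] Matrix (Fin 2 × Fin 2) (Fin 2 × Fin 2) ℂ :=
  measurePrepare ((1 / 2 : ℂ) • (diagonal (fun i => (d i : ℂ)) + K)) (flag 0 ⊗ₖ maxCoherent 2) +
  measurePrepare ((1 / 2 : ℂ) • (diagonal (fun i => (d i : ℂ)) - K))
    (flag 0 ⊗ₖ (1 - maxCoherent 2)) +
  measurePrepare (1 - diagonal fun i => (d i : ℂ)) (flag 1 ⊗ₖ ((1 / 2 : ℂ) • 1))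

lemma distill_apply [Fintype a] [DecidableEq a] (d : a → ℝ) (K X : Matrix a a ℂ) :
    distill d K X =
      ((1 / 2 : ℂ) * ((diagonal (fun i => (d i : ℂ)) * X).trace + (K * X).trace)) •
        (flag 0 ⊗ₖ maxCoherent 2) +
      ((1 / 2 : ℂ) * ((diagonal (fun i => (d i : ℂ)) * X).trace - (K * X).trace)) •
        (flag 0 ⊗ₖ (1 - maxCoherent 2)) +
      (X.trace - (diagonal (fun i => (d i : ℂ)) * X).trace) • (flag 1 ⊗ₖ ((1 / 2 : ℂ) • 1)) := by
  simp only [distill, LinearMap.add_apply, measurePrepare_apply, smul_mul, add_mul, sub_mul,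
    trace_smul, trace_add, trace_sub, smul_eq_mul, one_mul]

/-- The three prepared states have populations independent of the sign of the success outcome, so
the dephased output depends on `X` through `Tr(diag d X)` and `Tr X` only. As `K` has zero diagonal,
dephasing the input leaves these numbers unchanged and prepares `Ψ₂` and `1 - Ψ₂` with equal weight,
which is a diagonal output. -/
lemma distill_isDephasingCovariant [Fintype a] [DecidableEq a] {d : a → ℝ} {K : Matrix a a ℂ}
    (hd : ∀ i, d i ≤ 1) (hK : ∀ i, K i i = 0)
    (hplus : (diagonal (fun i => (d i : ℂ)) + K).PosSemidef)
    (hminus : (diagonal (fun i => (d i : ℂ)) - K).PosSemidef) :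
    IsDephasingCovariantOperation (distill d K) := by
  have hhalf : (0 : ℂ) ≤ 1 / 2 := by
    rw [Complex.nonneg_iff]; norm_num
  refine ⟨⟨?_, fun X => ?_⟩, fun X => ?_⟩
  · refine ((isCompletelyPositive_measurePrepare (hplus.smul hhalf)
      ((flag_posSemidef 0).kronecker maxCoherent_posSemidef)).add
      (isCompletelyPositive_measurePrepare (hminus.smul hhalf)
      ((flag_posSemidef 0).kronecker one_sub_maxCoherent_posSemidef))).add
      (isCompletelyPositive_measurePrepare ?_
      ((flag_posSemidef 1).kronecker (PosSemidef.one.smul hhalf)))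
    rw [← diagonal_one, diagonal_sub]
    refine PosSemidef.diagonal fun i => ?_
    simpa using Complex.real_le_real.2 (hd i)
  · rw [distill_apply]
    simp only [trace_add, trace_smul, trace_kronecker, trace_flag, trace_sub, trace_maxCoherent,
      trace_one, smul_eq_mul, Fintype.card_fin]
    push_cast
    ring
  · have hKX : (K * dephase X).trace = 0 := by
      simp [dephase, trace, hK]
    have hD : (diagonal (fun i => (d i : ℂ)) * dephase X).trace =
        (diagonal (fun i => (d i : ℂ)) * X).trace := by
      simp [dephase, trace]
    have hT : (dephase X).trace = X.trace := by
      simp [dephase, trace]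
    rw [distill_apply, distill_apply, hKX, hD, hT]
    ext ⟨s, i⟩ ⟨t, j⟩
    fin_cases s <;> fin_cases t <;> fin_cases i <;> fin_cases j <;>
      simp [dephase, flag, kroneckerMap_apply, maxCoherent_two_apply] <;> ring

/-- Achievability from a primal witness `(d, K)`: if `K` has zero diagonal and `-diag d ≤ K ≤ diag d
≤ 1`, then success probability `Tr(diag d ρ)` is reached with fidelity `f`, where
`Tr(K ρ) = p (2 f - 1)`. -/
lemma mem_achievableProbabilities_of_witness (O : OperationClass) [Fintype a] [DecidableEq a]
    {ρ : Matrix a a ℂ} {d : a → ℝ} {K : Matrix a a ℂ} {p f ε : ℝ}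
    (hd : ∀ i, d i ≤ 1) (hK : ∀ i, K i i = 0)
    (hplus : (diagonal (fun i => (d i : ℂ)) + K).PosSemidef)
    (hminus : (diagonal (fun i => (d i : ℂ)) - K).PosSemidef)
    (hρ : ρ.trace = 1) (hp0 : 0 ≤ p) (hp1 : p ≤ 1) (hf0 : 0 ≤ f) (hf1 : f ≤ 1) (hf : 1 - ε ≤ f)
    (hdρ : (diagonal (fun i => (d i : ℂ)) * ρ).trace = p)
    (hKρ : (K * ρ).trace = ((p * (2 * f - 1) : ℝ) : ℂ)) :
    p ∈ achievableProbabilities O ρ 2 ε := by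
  have hσ : ((f : ℂ) • maxCoherent 2 + ((1 - f : ℝ) : ℂ) • (1 - maxCoherent 2)).PosSemidef :=
    (maxCoherent_posSemidef.smul (by exact_mod_cast hf0)).add
      (one_sub_maxCoherent_posSemidef.smul (by exact_mod_cast sub_nonneg.2 hf1))
  refine ⟨hp0, hp1, distill d K,
    (f : ℂ) • maxCoherent 2 + ((1 - f : ℝ) : ℂ) • (1 - maxCoherent 2), (1 / 2 : ℂ) • 1,
    O.contains_of_dephasingCovariant (distill_isDephasingCovariant hd hK hplus hminus),
    ⟨hσ, ?_⟩, ⟨PosSemidef.one.smul (by rw [Complex.nonneg_iff]; norm_num), ?_⟩, ?_, ?_⟩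
  · simp only [trace_add, trace_smul, trace_sub, trace_maxCoherent, trace_one, Fintype.card_fin,
      smul_eq_mul]
    push_cast
    ring
  · simp
  · rw [distill_apply, hdρ, hKρ, hρ, flaggedOutput]
    simp only [kronecker_add, kronecker_smul, smul_add, smul_smul, flag]
    push_cast
    module
  · rw [fidelity_maxCoherent hσ, mul_add, Matrix.mul_smul, Matrix.mul_smul, mul_sub, mul_one,
      maxCoherent_mul_self, sub_self, smul_zero, add_zero, trace_smul, trace_maxCoherent]
    simpa using hf

/-! ### The converse bound for maximally incoherent operations -/

/-- The matrix representing the functional `X ↦ Tr(G E(X))`, i.e. the effect `G` in the Heisenberg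
picture. -/
def pullback [DecidableEq a] [Fintype b] (E : Matrix a a ℂ →ₗ[ℂ] Matrix b b ℂ)
    (G : Matrix b b ℂ) : Matrix a a ℂ :=
  Matrix.of fun i j => (G * E (single j i 1)).trace

lemma trace_pullback_mul [Fintype a] [DecidableEq a] [Fintype b]
    (E : Matrix a a ℂ →ₗ[ℂ] Matrix b b ℂ) (G : Matrix b b ℂ) (X : Matrix a a ℂ) :
    (pullback E G * X).trace = (G * E X).trace := by
  have hX : E X = ∑ i, ∑ j, X i j • E (single i j 1) := by
    conv_lhs => rw [matrix_eq_sum_single X]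
    simp only [map_sum, ← map_smul, smul_single, smul_eq_mul, mul_one]
  rw [hX]
  simp only [Finset.mul_sum, trace_sum, Matrix.mul_smul, trace_smul, smul_eq_mul]
  rw [Finset.sum_comm]
  rw [trace]
  simp only [diag_apply, mul_apply (M := pullback E G)]
  exact Finset.sum_congr rfl fun i _ => Finset.sum_congr rfl fun j _ => mul_comm _ _

lemma pullback_posSemidef [Fintype a] [DecidableEq a] [Fintype b] [DecidableEq b]
    {E : Matrix a a ℂ →ₗ[ℂ] Matrix b b ℂ} (hE : IsCompletelyPositive E) {G : Matrix b b ℂ}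
    (hG : G.PosSemidef) : (pullback E G).PosSemidef := by
  have key (v : a → ℂ) : 0 ≤ star v ⬝ᵥ (pullback E G *ᵥ v) := by
    rw [← trace_mul_pureState, trace_pullback_mul]
    exact trace_mul_nonneg hG (hE.posSemidef (pureState_posSemidef v))
  rw [← isPositive_toEuclideanLin_iff, LinearMap.isPositive_iff_complex]
  intro v
  have h := star_nonneg_iff.2 (key v.ofLp)
  have e : inner ℂ ((toEuclideanLin (pullback E G)) v) v =
      star (star v.ofLp ⬝ᵥ (pullback E G *ᵥ v.ofLp)) := by
    rw [EuclideanSpace.inner_eq_star_dotProduct, ← star_dotProduct_star, star_star,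
      dotProduct_comm]
    rfl
  rw [e]
  exact ⟨(Complex.eq_re_of_ofReal_le h).symm, (Complex.nonneg_iff.1 h).1⟩

lemma exists_linearMap_norm_sq_eq [Fintype a] [DecidableEq a] {A : Matrix a a ℂ}
    (hA : A.PosSemidef) : ∃ L : (a → ℂ) →ₗ[ℂ] EuclideanSpace ℂ a,
      ∀ v, star v ⬝ᵥ (A *ᵥ v) = ((‖L v‖ ^ 2 : ℝ) : ℂ) := by
  obtain ⟨B, rfl⟩ := CStarAlgebra.nonneg_iff_eq_star_mul_self.mp hA.nonneg
  refine ⟨(WithLp.linearEquiv 2 ℂ (a → ℂ)).symm.toLinearMap ∘ₗ B.mulVecLin, fun v => ?_⟩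
  rw [star_eq_conjTranspose, ← mulVec_mulVec, dotProduct_mulVec, ← star_mulVec,
    EuclideanSpace.norm_sq_eq]
  simp [dotProduct, Complex.conj_mul']

/-- Two positive effects with equal weight on the basis vector `k` can be told apart on `φ` only
through the rest `φ'` of `φ`: the seminorms of `A` and `C` agree on `k`, so the triangle inequality
bounds the difference of the seminorms of `φ` by their sum on `φ'`. -/
lemma mul_sq_le_of_effects [Fintype a] [DecidableEq a] {A C : Matrix a a ℂ} (hA : A.PosSemidef)
    (hC : C.PosSemidef) {k : a} (hk : A k k = C k k) {φ φ' : a → ℂ} {x : ℂ}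
    (hφ : φ = x • Pi.single k 1 + φ') {u v r : ℝ} (hv : 0 ≤ v) (huv : v ≤ u)
    (hAφ : u ^ 2 ≤ (star φ ⬝ᵥ (A *ᵥ φ)).re) (hCφ : (star φ ⬝ᵥ (C *ᵥ φ)).re ≤ v ^ 2)
    (hr : (star φ' ⬝ᵥ (A *ᵥ φ')).re + (star φ' ⬝ᵥ (C *ᵥ φ')).re ≤ r) :
    (u - v) ^ 2 ≤ 2 * r := by
  obtain ⟨L, hL⟩ := exists_linearMap_norm_sq_eq hA
  obtain ⟨M, hM⟩ := exists_linearMap_norm_sq_eq hC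
  have hkk : ‖L (Pi.single k 1)‖ = ‖M (Pi.single k 1)‖ := by
    have h1 := hL (Pi.single k 1)
    have h2 := hM (Pi.single k 1)
    simp only [← Pi.single_star, star_one, mulVec_single_one, single_one_dotProduct, col_apply]
      at h1 h2
    rw [h1, h2] at hk
    exact (pow_left_inj₀ (norm_nonneg _) (norm_nonneg _) two_ne_zero).1 (by exact_mod_cast hk)
  rw [hL, Complex.ofReal_re] at hAφ
  rw [hM, Complex.ofReal_re] at hCφ
  rw [hL, hM, Complex.ofReal_re, Complex.ofReal_re] at hr
  have h1 : u ≤ ‖L φ‖ := le_of_sq_le_sq hAφ (norm_nonneg _)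
  have h2 : ‖M φ‖ ≤ v := le_of_sq_le_sq hCφ hv
  have h3 : ‖L φ‖ ≤ ‖x‖ * ‖L (Pi.single k 1)‖ + ‖L φ'‖ := by
    rw [hφ, map_add, map_smul, ← norm_smul]
    exact norm_add_le _ _
  have h4 : ‖x‖ * ‖M (Pi.single k 1)‖ ≤ ‖M φ‖ + ‖M φ'‖ := by
    rw [hφ, map_add, map_smul, ← norm_smul]
    simpa using norm_sub_le (x • M (Pi.single k 1) + M φ') (M φ')
  rw [hkk] at h3
  nlinarith [sq_nonneg (‖L φ'‖ - ‖M φ'‖)]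

lemma isIncoherent_single [Fintype a] [DecidableEq a] (i : a) :
    IsIncoherent (single i i (1 : ℂ)) := by
  refine ⟨⟨?_, by simp⟩, ?_⟩ <;> rw [← diagonal_single]
  · refine PosSemidef.diagonal fun j => ?_
    simp only [Pi.zero_apply, Pi.single_apply]
    split_ifs <;> simp
  · exact isDiag_diagonal _

lemma flag_kronecker_mul_flaggedOutput (G σ ω : Matrix (Fin 2) (Fin 2) ℂ) (p : ℝ) :
    ((flag 0 ⊗ₖ G) * flaggedOutput p σ ω).trace = p * (G * σ).trace := by
  have h0 : flag 0 * single (0 : Fin 2) (0 : Fin 2) (1 : ℂ) = single 0 0 1 := by simp [flag]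
  have h1 : flag 0 * single (1 : Fin 2) (1 : Fin 2) (1 : ℂ) = 0 := by simp [flag]
  rw [flaggedOutput, mul_add, Matrix.mul_smul, Matrix.mul_smul, ← mul_kronecker_mul,
    ← mul_kronecker_mul, h0, h1, zero_kronecker, smul_zero, add_zero, trace_smul, trace_kronecker]
  simp

/-- Converse bound for maximally incoherent operations and a pure input `φ = x |k⟩ + φ'`. -/
lemma mul_sq_le_of_mem_achievableProbabilities {O : OperationClass} [Fintype a] [DecidableEq a]
    {φ φ' : a → ℂ} {x : ℂ} {k : a} (hφ : φ = x • Pi.single k 1 + φ') {p ε : ℝ} (hε : 0 ≤ ε)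
    (hε' : ε ≤ 1 / 2) (hp : p ∈ achievableProbabilities O (pureState φ) 2 ε) :
    p * (√(1 - ε) - √ε) ^ 2 ≤ 2 * (star φ' ⬝ᵥ φ').re := by
  obtain ⟨hp0, -, E, σ, ω, hO, hσ, hω, hE, hF⟩ := hp
  obtain ⟨⟨hcp, htp⟩, hinc⟩ := hO.isMaximallyIncoherentOperation
  rw [fidelity_maxCoherent hσ.1] at hF
  have hG := (flag_posSemidef 0).kronecker maxCoherent_posSemidef
  have hH := (flag_posSemidef 0).kronecker one_sub_maxCoherent_posSemidef
  have hkk : pullback E (flag 0 ⊗ₖ maxCoherent 2) k k =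
      pullback E (flag 0 ⊗ₖ (1 - maxCoherent 2)) k k := by
    have hd := (hinc _ (isIncoherent_single k)).2
    rw [pullback, pullback, of_apply, of_apply, ← hd.diagonal_diag, trace, trace]
    refine Finset.sum_congr rfl fun ⟨s, i⟩ _ => ?_
    rw [diag_apply, diag_apply, mul_diagonal, mul_diagonal]
    congr 1
    simp only [kroneckerMap_apply, Matrix.sub_apply, one_apply_eq, maxCoherent_two_apply]
    ring
  have h := mul_sq_le_of_effects (pullback_posSemidef hcp hG) (pullback_posSemidef hcp hH) hkk hφ
    (u := √p * √(1 - ε)) (v := √p * √ε) (r := (star φ' ⬝ᵥ φ').re) (by positivity)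
    (by gcongr; linarith) ?_ ?_ ?_
  · rwa [← mul_sub, mul_pow, Real.sq_sqrt hp0] at h
  · rw [← trace_mul_pureState, trace_pullback_mul, hE, flag_kronecker_mul_flaggedOutput,
      Complex.re_ofReal_mul, mul_pow, Real.sq_sqrt hp0, Real.sq_sqrt (by linarith)]
    gcongr
  · rw [← trace_mul_pureState, trace_pullback_mul, hE, flag_kronecker_mul_flaggedOutput,
      Complex.re_ofReal_mul, mul_pow, Real.sq_sqrt hp0, Real.sq_sqrt hε, sub_mul, trace_sub,
      one_mul, hσ.2, Complex.sub_re, Complex.one_re]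
    gcongr
    linarith
  · -- The two effects add up to `|0⟩⟨0| ⊗ 1 ≤ 1`.
    have h1 : flag 0 ⊗ₖ maxCoherent 2 + flag 0 ⊗ₖ (1 - maxCoherent 2) +
        flag 1 ⊗ₖ (1 : Matrix (Fin 2) (Fin 2) ℂ) = 1 := by
      rw [← kronecker_add, add_sub_cancel, ← add_kronecker, ← one_kronecker_one]
      congr 1
      ext i j
      fin_cases i <;> fin_cases j <;> simp [flag]
    have h2 := (Complex.nonneg_iff.1 (trace_mul_nonneg ((flag_posSemidef 1).kronecker
      (PosSemidef.one (n := Fin 2))) (hcp.posSemidef (pureState_posSemidef φ')))).1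
    have h3 := congrArg (fun X => (X * E (pureState φ')).trace.re) h1
    simp only [add_mul, trace_add, Complex.add_re, one_mul, htp, trace_pureState] at h3
    rw [← trace_mul_pureState, trace_pullback_mul, ← trace_mul_pureState, trace_pullback_mul]
    linarith

/-! ### Witnesses: closed polygons and a dominant component -/

/-- Vectors of lengths at most `M`, laid out one after the other, can be directed so that their sum
never leaves the disc of radius `M`: direct each one against the current sum. -/
lemma exists_phases_norm_sum_le {ι : Type*} (s : Finset ι) {c : ι → ℝ} {M : ℝ} (hM : 0 ≤ M)
    (h0 : ∀ i, 0 ≤ c i) (hcM : ∀ i, c i ≤ M) :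
    ∃ θ : ι → ℝ, ‖∑ i ∈ s, (c i : ℂ) * Complex.exp (θ i * Complex.I)‖ ≤ M := by
  classical
  induction s using Finset.induction_on with
  | empty => exact ⟨0, by simpa using hM⟩
  | insert i s hi ih =>
    obtain ⟨θ, hθ⟩ := ih
    set T := ∑ i ∈ s, (c i : ℂ) * Complex.exp (θ i * Complex.I) with hT
    refine ⟨Function.update θ i (T.arg + Real.pi), ?_⟩
    have hrest : ∑ j ∈ s, (c j : ℂ) *
        Complex.exp ((Function.update θ i (T.arg + Real.pi) j : ℝ) * Complex.I) = T := by
      refine Finset.sum_congr rfl fun j hj => ?_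
      rw [Function.update_of_ne (ne_of_mem_of_not_mem hj hi)]
    have hexp : Complex.exp (((T.arg + Real.pi : ℝ) : ℂ) * Complex.I) =
        -Complex.exp (T.arg * Complex.I) := by
      rw [Complex.ofReal_add, add_mul, Complex.exp_add, Complex.exp_pi_mul_I, mul_neg_one]
    rw [Finset.sum_insert hi, hrest, Function.update_self, hexp]
    have : (c i : ℂ) * -Complex.exp (T.arg * Complex.I) + T =
        ((‖T‖ - c i : ℝ) : ℂ) * Complex.exp (T.arg * Complex.I) := by
      linear_combination (norm := (push_cast; ring)) -Complex.norm_mul_exp_arg_mul_I T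
    rw [this, norm_mul, Complex.norm_exp_ofReal_mul_I, mul_one, Complex.norm_real,
      Real.norm_eq_abs, abs_le]
    constructor <;> linarith [h0 i, hcM i, norm_nonneg T]

/-- The polygon inequality is sufficient: side lengths of which the largest does not exceed the sum
of the others are those of a closed polygon in the plane. -/
lemma exists_phases_sum_eq_zero {ι : Type*} [Fintype ι] [DecidableEq ι] {c : ι → ℝ} {k : ι}
    (hk : 0 < c k) (h0 : ∀ i, 0 ≤ c i) (hck : ∀ i, c i ≤ c k)
    (hsum : c k ≤ ∑ i ∈ Finset.univ.erase k, c i) :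
    ∃ z : ι → ℂ, (∀ i, ‖z i‖ = 1) ∧ ∑ i, (c i : ℂ) * z i = 0 := by
  let f : (ι → ℝ) → ℂ := fun θ =>
    ∑ i ∈ Finset.univ.erase k, (c i : ℂ) * Complex.exp (θ i * Complex.I)
  have hf : Continuous f := by fun_prop
  have hle : ∃ θ, ‖f θ‖ ≤ c k := exists_phases_norm_sum_le _ hk.le h0 hck
  have hge : ∃ θ, c k ≤ ‖f θ‖ := by
    refine ⟨0, ?_⟩
    have : f 0 = ((∑ i ∈ Finset.univ.erase k, c i : ℝ) : ℂ) := by simp [f]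
    rw [this, Complex.norm_real]
    exact hsum.trans (le_abs_self _)
  obtain ⟨θ, hθ⟩ := mem_range_of_exists_le_of_exists_ge hf.norm hle hge
  have hθ : ‖f θ‖ = c k := hθ
  have hk' : (c k : ℂ) ≠ 0 := by exact_mod_cast hk.ne'
  refine ⟨Function.update (fun i => Complex.exp (θ i * Complex.I)) k (-f θ / c k), fun i => ?_, ?_⟩
  · rcases eq_or_ne i k with rfl | hi
    · rw [Function.update_self, norm_div, norm_neg, hθ, Complex.norm_real,
        Real.norm_of_nonneg hk.le, div_self hk.ne']
    · rw [Function.update_of_ne hi, Complex.norm_exp_ofReal_mul_I]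
  · rw [← Finset.add_sum_erase _ _ (Finset.mem_univ k), Function.update_self, mul_div_cancel₀ _ hk']
    have : ∑ i ∈ Finset.univ.erase k, (c i : ℂ) *
        Function.update (fun i => Complex.exp (θ i * Complex.I)) k (-f θ / c k) i = f θ := by
      refine Finset.sum_congr rfl fun j hj => ?_
      rw [Function.update_of_ne (Finset.ne_of_mem_erase hj)]
    rw [this, neg_add_cancel]

lemma star_ofReal_dotProduct [Fintype a] (φ : a → ℝ) :
    (star fun i => (φ i : ℂ)) ⬝ᵥ (fun i => (φ i : ℂ)) = ((∑ i, φ i ^ 2 : ℝ) : ℂ) := by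
  simp [dotProduct, sq]

/-- If no population exceeds `1/2`, phases turn `φ` into an orthogonal vector `ψ` with the same
populations, and `K = |φ⟩⟨φ| - |ψ⟩⟨ψ|` witnesses deterministic exact distillation. -/
lemma one_mem_achievableProbabilities_of_sq_le (O : OperationClass) [Fintype a] [DecidableEq a]
    {φ : a → ℝ} (hnorm : ∑ i, φ i ^ 2 = 1) {k : a} (hk : 0 < φ k)
    (hφ : ∀ i, φ i ^ 2 ≤ φ k ^ 2) (hhalf : φ k ^ 2 ≤ 1 / 2) {ε : ℝ} (hε : 0 ≤ ε) :
    (1 : ℝ) ∈ achievableProbabilities O (pureState fun i => (φ i : ℂ)) 2 ε := by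
  obtain ⟨z, hz, hsum⟩ := exists_phases_sum_eq_zero (c := fun i => φ i ^ 2) (k := k) (by positivity)
    (fun i => sq_nonneg _) hφ (by rw [Finset.sum_erase_eq_sub (Finset.mem_univ k)]; linarith)
  have hz' (i : a) : z i * star (z i) = 1 := by
    have := Complex.mul_conj' (z i)
    simpa [hz] using this
  set φc : a → ℂ := fun i => (φ i : ℂ) with hφc
  set ψ : a → ℂ := fun i => z i * φ i with hψ
  have hφφ : star φc ⬝ᵥ φc = 1 := by
    rw [hφc, star_ofReal_dotProduct, hnorm, Complex.ofReal_one]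
  have hψψ : star ψ ⬝ᵥ ψ = 1 := by
    rw [← hφφ]
    refine Finset.sum_congr rfl fun i _ => ?_
    have := hz' i
    simp only [hψ, hφc, Pi.star_apply, star_mul']
    linear_combination (star (φ i : ℂ) * φ i) * this
  have hφψ : star φc ⬝ᵥ ψ = 0 := by
    rw [← hsum]
    refine Finset.sum_congr rfl fun i _ => ?_
    simp [hφc, hψ]
    ring
  have hP := one_sub_pureState_posSemidef hφφ.le
  have hQ := one_sub_pureState_posSemidef hψψ.le
  have hD : (diagonal fun _ : a => ((1 : ℝ) : ℂ)) = 1 := by simp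
  refine mem_achievableProbabilities_of_witness O (d := fun _ => 1)
    (K := pureState φc - pureState ψ) (f := 1) (fun _ => le_rfl) (fun i => ?_) ?_ ?_ ?_ zero_le_one
    le_rfl zero_le_one le_rfl (by linarith) ?_ ?_
  · have := hz' i
    simp only [Matrix.sub_apply, pureState, vecMulVec_apply, hφc, hψ, Pi.star_apply, star_mul']
    linear_combination (-(star (φ i : ℂ) * φ i)) * this
  · rw [hD]
    convert hQ.add (pureState_posSemidef φc) using 1
    abel
  · rw [hD]
    convert hP.add (pureState_posSemidef ψ) using 1
    abel
  · rw [trace_pureState, hφφ]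
  · rw [hD, one_mul, trace_pureState, hφφ, Complex.ofReal_one]
  · rw [trace_mul_pureState, sub_mulVec, dotProduct_sub, pureState, pureState, vecMulVec_mulVec,
      vecMulVec_mulVec, dotProduct_smul, dotProduct_smul, hφφ, hφψ]
    norm_num

/-- The part of a real vector orthogonal to the basis vector `k`. -/
def offPart [DecidableEq a] (φ : a → ℝ) (k : a) : a → ℝ := fun i => if i = k then 0 else φ i

lemma sum_offPart_sq [Fintype a] [DecidableEq a] {φ : a → ℝ} (hnorm : ∑ i, φ i ^ 2 = 1) (k : a) :
    ∑ i, offPart φ k i ^ 2 = 1 - φ k ^ 2 := by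
  rw [← Finset.add_sum_erase _ _ (Finset.mem_univ k), ← hnorm,
    ← Finset.sum_erase_eq_sub (Finset.mem_univ k)]
  simp only [offPart, if_true, ne_eq, OfNat.ofNat_ne_zero, not_false_eq_true, zero_pow, zero_add]
  exact Finset.sum_congr rfl fun i hi => by rw [if_neg (Finset.ne_of_mem_erase hi)]

lemma ofReal_eq_single_add_offPart [DecidableEq a] (φ : a → ℝ) (k : a) :
    (fun i => (φ i : ℂ)) = (φ k : ℂ) • Pi.single k 1 + fun i => (offPart φ k i : ℂ) := by
  ext i
  rcases eq_or_ne i k with rfl | hi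
  · simp [offPart]
  · simp [offPart, hi]

/-- The witness for a large population `x² = φₖ²`: `diag d` damps the basis vector `k` by `t²`, and
`K` couples `k`, with amplitude `t`, to the normalized remainder `w` of `φ`. When `φ = |k⟩` the
remainder vanishes and `w` is the junk value `0`, for which the construction is still valid. -/
lemma mem_achievableProbabilities_of_amplitude (O : OperationClass) [Fintype a] [DecidableEq a]
    {φ : a → ℝ} (hnorm : ∑ i, φ i ^ 2 = 1) (k : a) {t y p f ε : ℝ}
    (hy : y ^ 2 = 1 - φ k ^ 2) (ht0 : 0 ≤ t) (ht1 : t ≤ 1) (hf0 : 0 ≤ f) (hf1 : f ≤ 1)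
    (hf : 1 - ε ≤ f) (hp : p = t ^ 2 * φ k ^ 2 + y ^ 2) (hpf : p * (2 * f - 1) = 2 * t * φ k * y) :
    p ∈ achievableProbabilities O (pureState fun i => (φ i : ℂ)) 2 ε := by
  obtain ⟨w, hwk, hww, hwφ⟩ : ∃ w : a → ℝ, w k = 0 ∧ ∑ i, w i ^ 2 ≤ 1 ∧ ∑ i, w i * φ i = y := by
    refine ⟨fun i => offPart φ k i / y, by simp [offPart], ?_, ?_⟩
    · simp only [div_pow]
      rw [← Finset.sum_div, sum_offPart_sq hnorm, hy]
      exact div_self_le_one _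
    · have : ∀ i, offPart φ k i / y * φ i = offPart φ k i ^ 2 / y := fun i => by
        simp only [offPart]; split_ifs <;> ring
      rw [Finset.sum_congr rfl fun i _ => this i, ← Finset.sum_div, sum_offPart_sq hnorm, ← hy, sq,
        mul_self_div_self]
  let e : a → ℝ := fun i => if i = k then 1 else 0
  let d : a → ℝ := fun i => if i = k then t ^ 2 else 1
  let K : Matrix a a ℂ := Matrix.of fun i j => ((t * (e i * w j + w i * e j) : ℝ) : ℂ)
  have hR := (one_sub_pureState_posSemidef (ψ := fun i => (w i : ℂ))
    (by rw [star_ofReal_dotProduct]; exact_mod_cast hww)).conjTranspose_mul_mul_same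
      (diagonal fun i => ((1 - e i : ℝ) : ℂ))
  -- `diag d ± K` is the rank-one operator of `t |k⟩ ± |w⟩` plus the compression of `1 - |w⟩⟨w|` to
  -- the complement of `k`.
  have hdecomp (s : ℝ) (hs : s ^ 2 = 1) : (diagonal fun i => (d i : ℂ)) + (s : ℂ) • K =
      pureState (fun i => ((t * e i + s * w i : ℝ) : ℂ)) +
      (diagonal fun i => ((1 - e i : ℝ) : ℂ))ᴴ * (1 - pureState fun i => (w i : ℂ)) *
        diagonal fun i => ((1 - e i : ℝ) : ℂ) := by
    have hsc : (s : ℂ) * s = 1 := by exact_mod_cast (sq s).symm.trans hs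
    ext i j
    simp only [diagonal_conjTranspose, mul_diagonal, diagonal_mul, Matrix.add_apply,
      Matrix.sub_apply, Matrix.smul_apply, pureState, vecMulVec_apply, Pi.star_apply, K, of_apply,
      diagonal_apply, Matrix.one_apply, RCLike.star_def, Complex.conj_ofReal, smul_eq_mul, d, e]
    by_cases hi : i = k <;> by_cases hj : j = k
    · simp [hi, hj, hwk, sq]
    · simp [hi, hj, Ne.symm hj, hwk]; ring
    · simp [hi, hj, hwk]; ring
    · rcases eq_or_ne i j with rfl | hij
      · simp [hi]; linear_combination (-(w i * w i : ℂ)) * hsc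
      · simp [hi, hj, hij]; linear_combination (-(w i * w j : ℂ)) * hsc
  have hp0 : 0 ≤ p := by rw [hp]; positivity
  have hp1 : p ≤ 1 := by
    have : t ^ 2 * φ k ^ 2 ≤ 1 * φ k ^ 2 := by gcongr; exact pow_le_one₀ ht0 ht1
    linarith
  refine mem_achievableProbabilities_of_witness O (d := d) (K := K) (f := f) (fun i => ?_)
    (fun i => ?_) ?_ ?_ ?_ hp0 hp1 hf0 hf1 hf ?_ ?_
  · simp only [d]
    split_ifs
    exacts [pow_le_one₀ ht0 ht1, le_rfl]
  · by_cases hi : i = k <;> simp [K, e, hi, hwk]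
  · have := hdecomp 1 (by norm_num)
    rw [Complex.ofReal_one, one_smul] at this
    rw [this]
    exact (pureState_posSemidef _).add hR
  · have := hdecomp (-1) (by norm_num)
    rw [Complex.ofReal_neg, Complex.ofReal_one, neg_one_smul, ← sub_eq_add_neg] at this
    rw [this]
    exact (pureState_posSemidef _).add hR
  · rw [trace_pureState, star_ofReal_dotProduct, hnorm, Complex.ofReal_one]
  · have h1 : ∑ i, d i * φ i ^ 2 = p := by
      have : ∀ i, d i * φ i ^ 2 = (if i = k then t ^ 2 * φ k ^ 2 else 0) + offPart φ k i ^ 2 :=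
        fun i => by simp only [d, offPart]; split_ifs with h <;> simp [h]
      rw [Finset.sum_congr rfl fun i _ => this i, Finset.sum_add_distrib, sum_offPart_sq hnorm]
      simp [hp, hy]
    rw [← h1, trace_mul_pureState]
    simp only [dotProduct, mulVec_diagonal, Pi.star_apply, RCLike.star_def, Complex.conj_ofReal]
    push_cast
    exact Finset.sum_congr rfl fun i _ => by ring
  · have h2 : ∑ i, e i * φ i = φ k := by simp [e]
    have hKφ : K *ᵥ (fun i => (φ i : ℂ)) = fun i => ((t * (e i * y + w i * φ k) : ℝ) : ℂ) := by
      ext i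
      rw [← hwφ, ← h2]
      simp only [mulVec, dotProduct, K, of_apply, Finset.mul_sum, ← Complex.ofReal_mul,
        ← Complex.ofReal_sum, ← Finset.sum_add_distrib]
      congr 1
      exact Finset.sum_congr rfl fun j _ => by ring
    have h3 : ∑ i, φ i * (t * (e i * y + w i * φ k)) = 2 * t * φ k * y := by
      calc ∑ i, φ i * (t * (e i * y + w i * φ k))
          = t * y * ∑ i, e i * φ i + t * φ k * ∑ i, w i * φ i := by
            rw [Finset.mul_sum, Finset.mul_sum, ← Finset.sum_add_distrib]
            exact Finset.sum_congr rfl fun i _ => by ring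
        _ = _ := by rw [h2, hwφ]; ring
    rw [trace_mul_pureState, hKφ, hpf, ← h3]
    simp [dotProduct]

/-! ### The threshold -/

lemma sqrt_sub_mul_sqrt_add {ε : ℝ} (h0 : 0 ≤ ε) (h1 : ε ≤ 1) :
    (√(1 - ε) - √ε) * (√(1 - ε) + √ε) = 1 - 2 * ε := by
  have h2 := Real.sq_sqrt h0
  have h3 := Real.sq_sqrt (sub_nonneg.2 h1)
  linear_combination h3 - h2

lemma le_one_div_sqrt_two_iff {x : ℝ} (hx : 0 ≤ x) : x ≤ 1 / √2 ↔ x ^ 2 ≤ 1 / 2 := by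
  rw [one_div, ← Real.sqrt_inv, Real.le_sqrt hx (by norm_num), one_div]

/-- Below the threshold infidelity, the amplitude `y (a + b) / (x (a - b))`, with `a = √(1 - ε)` and
`b = √ε`, by which the optimal protocol damps the largest component, is at most one. -/
lemma mul_sqrt_add_le {x y ε : ℝ} (hx : 0 ≤ x) (hy : 0 ≤ y) (hxy : x ^ 2 + y ^ 2 = 1)
    (hx2 : 1 / 2 ≤ x ^ 2) (hε : 0 ≤ ε) (h : 2 * (x * y) ≤ 1 - 2 * ε) :
    y * (√(1 - ε) + √ε) ≤ x * (√(1 - ε) - √ε) := by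
  have hxy0 : 0 ≤ x * y := mul_nonneg hx hy
  have ha := Real.sq_sqrt (show 0 ≤ 1 - ε by linarith)
  have hb := Real.sq_sqrt hε
  have hab : √ε ≤ √(1 - ε) := Real.sqrt_le_sqrt (by linarith)
  have hab0 : 0 ≤ √(1 - ε) * √ε := by positivity
  -- Both sides are squared, which leaves `2 a b ≤ x² - y²`; a second squaring gives the hypothesis.
  have key : 2 * (√(1 - ε) * √ε) ≤ x ^ 2 - y ^ 2 := by
    refine le_of_sq_le_sq ?_ (by linarith)
    have h1 : (2 * (√(1 - ε) * √ε)) ^ 2 = 1 - (1 - 2 * ε) ^ 2 := by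
      rw [mul_pow, mul_pow, ha, hb]; ring
    have h2 : (x ^ 2 - y ^ 2) ^ 2 = 1 - (2 * (x * y)) ^ 2 := by
      linear_combination (x ^ 2 + y ^ 2 + 1) * hxy
    rw [h1, h2]
    gcongr
  refine le_of_sq_le_sq ?_ (mul_nonneg hx (sub_nonneg.2 hab))
  have h3 : (y * (√(1 - ε) + √ε)) ^ 2 = y ^ 2 * (1 + 2 * (√(1 - ε) * √ε)) := by
    linear_combination y ^ 2 * ha + y ^ 2 * hb
  have h4 : (x * (√(1 - ε) - √ε)) ^ 2 = x ^ 2 * (1 - 2 * (√(1 - ε) * √ε)) := by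
    linear_combination x ^ 2 * ha + x ^ 2 * hb
  rw [h3, h4]
  linear_combination key + 2 * (√(1 - ε) * √ε) * hxy

end CoherenceDistillation

theorem mainTheorem5 (O : CoherenceDistillation.OperationClass) {n : ℕ} (hn : 0 < n)
    (φ : Fin n → ℝ) (hanti : Antitone φ) (hpos : ∀ i, 0 < φ i) (hnorm : ∑ i, φ i ^ 2 = 1)
    (ε : ℝ) (hε : 0 ≤ ε) :
    CoherenceDistillation.IsMaxSuccessProbability O
      (CoherenceDistillation.pureState fun i => (φ i : ℂ)) 2 ε
      (if CoherenceDistillation.thresholdInfidelity (φ ⟨0, hn⟩) ≤ ε then 1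
       else 2 * (1 - φ ⟨0, hn⟩ ^ 2) * ((√(1 - ε) + √ε) / (1 - 2 * ε)) ^ 2) := by
  open CoherenceDistillation in
  set k : Fin n := ⟨0, hn⟩ with hk
  have hx : 0 < φ k := hpos k
  have hx1 : φ k ^ 2 ≤ 1 := by
    rw [← hnorm]
    exact Finset.single_le_sum (f := fun i => φ i ^ 2) (fun i _ => sq_nonneg _) (Finset.mem_univ k)
  have hy := Real.sq_sqrt (sub_nonneg.2 hx1)
  set y := √(1 - φ k ^ 2) with hydef
  have hy0 : 0 ≤ y := Real.sqrt_nonneg _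
  have hxy : φ k ^ 2 + y ^ 2 = 1 := by linarith
  have hxy0 : 0 ≤ φ k * y := mul_nonneg hx.le hy0
  have hxy1 : 2 * (φ k * y) ≤ 1 := by nlinarith [sq_nonneg (φ k - y)]
  split_ifs with hth
  · refine ⟨?_, fun p hp => hp.2.1⟩
    by_cases hhalf : φ k ≤ 1 / √2
    · refine one_mem_achievableProbabilities_of_sq_le O hnorm hx (fun i => ?_)
        ((le_one_div_sqrt_two_iff hx.le).1 hhalf) hε
      gcongr
      · exact (hpos i).le
      · exact hanti (Nat.zero_le _)
    · rw [thresholdInfidelity, if_neg hhalf] at hth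
      exact mem_achievableProbabilities_of_amplitude O hnorm k (t := 1)
        (f := (1 + 2 * (φ k * y)) / 2) hy zero_le_one le_rfl (by linarith) (by linarith)
        (by linarith) (by linarith) (by ring)
  · have hhalf : ¬ φ k ≤ 1 / √2 := fun h => hth (by rwa [thresholdInfidelity, if_pos h])
    rw [thresholdInfidelity, if_neg hhalf, not_le] at hth
    rw [le_one_div_sqrt_two_iff hx.le, not_le] at hhalf
    have hε2 : 0 < 1 - 2 * ε := by linarith
    have hfac := sqrt_sub_mul_sqrt_add hε (by linarith)
    have hle := mul_sqrt_add_le hx.le hy0 hxy hhalf.le hε (by linarith)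
    have hab : 0 < √(1 - ε) - √ε := sub_pos.2 (Real.sqrt_lt_sqrt hε (by linarith))
    have hr : (√(1 - ε) + √ε) / (1 - 2 * ε) = (√(1 - ε) - √ε)⁻¹ := by
      rw [← hfac, div_mul_cancel_right₀
        (add_pos_of_pos_of_nonneg (Real.sqrt_pos.2 (by linarith)) (Real.sqrt_nonneg ε)).ne']
    have ha2 := Real.sq_sqrt (show 0 ≤ 1 - ε by linarith)
    have hb2 := Real.sq_sqrt hε
    -- The claimed value is `2 y² / (√(1 - ε) - √ε)²`.
    rw [hr, ← hy]
    constructor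
    · refine mem_achievableProbabilities_of_amplitude O hnorm k
        (t := y * (√(1 - ε) + √ε) / (φ k * (√(1 - ε) - √ε))) (f := 1 - ε) hy (by positivity)
        (div_le_one_of_le₀ hle (by positivity)) (by linarith) (by linarith) le_rfl ?_ ?_
      · field_simp
        linear_combination (-2 * y ^ 2) * (ha2 + hb2)
      · rw [show 2 * (1 - ε) - 1 = 1 - 2 * ε by ring, ← hfac]
        field_simp
    · intro p hp
      have h := mul_sq_le_of_mem_achievableProbabilities
        (ofReal_eq_single_add_offPart φ k) hε (by linarith) hp
      rw [star_ofReal_dotProduct, sum_offPart_sq hnorm, Complex.ofReal_re, ← hy] at h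
      rw [inv_pow, ← div_eq_mul_inv, le_div_iff₀ (by positivity)]
      exact h
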